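/- For integers $n\ge 1$, $q\ge 2$ and $a$ put $$S_n(a,q)=\sum_{x\bmod q}e^{2\pi i a x^n/q},\qquad G_n(q)=\max_{\gcd(a,q)=1}|S_n(a,q)|.$$ Let $n\ge 2000$ be an integer and $p\ge 375000$ a prime, put $d=\gcd(n,p-1)$ and $t=(p-1)/d$, and let $g$ be a generator of the multiplicative group $(\mathbb Z/p\mathbb Z)^*$. For a residue class $b$ modulo $p$ let $\llbracket b\rrbracket_p$ denote the unique integer in the class $b$ with $-p/2<\llbracket b\rrbracket_p<p/2$. Suppose that $\varphi(t)\ge 25$, where $\varphi$ is the Euler function, and that $$\sum_{x=1}^{t}\llbracket g^{dx+y}\rrbracket_p^2\ \ge\ p^{48/25}\,t^{1/25}\qquad\text{for every integer } y \text{ with } 1\le y\le d.$$ Then $G_d(p)\le p^{1-1/n}$. -/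

import Mathlib

/-- `e(t) = exp(2πit)` for real `t`. -/
noncomputable def expE (t : ℝ) : ℂ :=
  Complex.exp (2 * Real.pi * Complex.I * t)

/-- The Gauss sum `S_n(a,q) = ∑_{x mod q} e(a xⁿ / q)`. -/
noncomputable def gaussS (n q : ℕ) (a : ℤ) : ℂ :=
  ∑ x ∈ Finset.range q, expE ((a : ℝ) * (x : ℝ) ^ n / (q : ℝ))

/-- `G_n(q)`, the largest absolute value of `S_n(a,q)` over the integers `a` coprime to `q`. -/
noncomputable def gaussG (n q : ℕ) : ℝ :=
  sSup {s : ℝ | ∃ a : ℤ, IsCoprime a (q : ℤ) ∧ s = ‖gaussS n q a‖}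

lemma norm_gaussS_le (n q : ℕ) (a : ℤ) : ‖gaussS n q a‖ ≤ q := by
  refine (norm_sum_le _ _).trans ?_
  have h : ∀ t : ℝ, ‖expE t‖ = 1 := fun t => by
    have : (2 * Real.pi * Complex.I * t : ℂ) = ((2 * Real.pi * t : ℝ) : ℂ) * Complex.I := by
      push_cast; ring
    rw [expE, this, Complex.norm_exp_ofReal_mul_I]
  simp [h]

/-- The supremum defining `G_n(q)` is that of a bounded set, so it dominates every term. -/
lemma norm_gaussS_le_gaussG (n q : ℕ) (a : ℤ) (ha : IsCoprime a (q : ℤ)) :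
    ‖gaussS n q a‖ ≤ gaussG n q := by
  refine le_csSup ⟨q, ?_⟩ ⟨a, ha, rfl⟩
  rintro _ ⟨b, -, rfl⟩
  exact norm_gaussS_le n q b

/-- For odd `p`, the unique integer congruent to `b` modulo `p` lying strictly between
`-p/2` and `p/2`. -/
def bracket (p : ℕ) (b : ZMod p) : ℤ :=
  b.valMinAbs

lemma bracket_spec (p : ℕ) (hp : Odd p) (b : ZMod p) :
    ((bracket p b : ℤ) : ZMod p) = b ∧
      -(p : ℝ) / 2 < (bracket p b : ℝ) ∧ (bracket p b : ℝ) < (p : ℝ) / 2 := by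
  obtain ⟨k, hk⟩ := hp
  haveI : NeZero p := ⟨by omega⟩
  have h := ZMod.valMinAbs_mem_Ioc b
  refine ⟨ZMod.coe_valMinAbs b, ?_, ?_⟩
  · have h1 : -(p : ℤ) < bracket p b * 2 := h.1
    have h2 : (-(p : ℝ)) < (bracket p b : ℝ) * 2 := by exact_mod_cast h1
    linarith
  · have h1 : bracket p b * 2 < (p : ℤ) :=
      lt_of_le_of_ne h.2 (by omega)
    have h2 : (bracket p b : ℝ) * 2 < (p : ℝ) := by exact_mod_cast h1
    linarith

/-! Let `H` be the group of `d`-th powers, so `|H| = t`, and let `η(b) = ∑_{h ∈ H} e(bh/p)`; then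
`S_d(a,p) = 1 + d η(a)`. For `d ≤ p^(49/100)`, Parseval's bound `|η| ≤ √p` suffices. Otherwise it is
enough that `|η(a)| ≤ t - X` with `X = p log p / d²`: then `|S_d(a,p)| ≤ p - p log p / d`, and `1 -
(log p)/n ≤ p^(-1/n)` finishes (`norm_gaussPeriod_le_sub`).

Suppose `|η(a)| > t - X`. Then the numbers `e(xh/p)`, `h ∈ H`, are close in `ℓ²` to a constant for
every `x ∈ aH`. Closeness adds up under sums, so `|η(x)| ≥ t - k²X` on the `k`-fold sumset of `aH`,
which has at least `k(t-1) + 1` elements by Cauchy–Davenport. Counting these layers against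
Parseval's `∑_{b ≠ 0} |η(b)|² = pt - t²` bounds `√(t/X)` linearly in `d/(t-1)`, which is absurd
unless `d` is large.

The hypothesis on squares excludes large `d`: with `cos` bounded by a parabola it gives `Re η(b) ≤ t
- q`, `q = 8 p^(-2/25) t^(1/25)`. If `η(a) = |η(a)|`, this forces `X > q`, hence `d < p^(111/200)`.
Otherwise `|η(a)|² = ∑_h Re η(a(h-1))` yields only about `X ≥ q/2`, hence `d < p^(116/200)`, but the
layers double in size: either `aH` and `-aH` are disjoint, or `η(a)` is a negative real and the
parity of `k` separates the signs (`two_mul_sum_le`). -/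

open scoped Pointwise ComplexConjugate

/-! ### Gaussian periods: Parseval and the autocorrelation identity -/

section Periods

variable {p : ℕ} [Fact p.Prime]

lemma ZMod.norm_stdAddChar (x : ZMod p) : ‖ZMod.stdAddChar x‖ = 1 := by
  rw [ZMod.stdAddChar_apply, Circle.norm_coe]

lemma ZMod.conj_stdAddChar (x : ZMod p) :
    conj (ZMod.stdAddChar x) = ZMod.stdAddChar (-x) := by
  rw [AddChar.map_neg_eq_inv, ZMod.stdAddChar_apply, ← Circle.coe_inv_eq_conj, Circle.coe_inv]

lemma ZMod.re_stdAddChar (x : ZMod p) :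
    (ZMod.stdAddChar x).re = Real.cos (2 * Real.pi * (x.valMinAbs / p)) := by
  conv_lhs => rw [← ZMod.coe_valMinAbs x, ZMod.stdAddChar_coe]
  have : (2 * Real.pi * Complex.I * (x.valMinAbs : ℤ) / (p : ℂ) : ℂ) =
      ((2 * Real.pi * (x.valMinAbs / p) : ℝ) : ℂ) * Complex.I := by
    push_cast; ring
  rw [this, Complex.exp_ofReal_mul_I_re]

/-- This is `cos θ ≤ 1 - 2θ²/π²` for `|θ| ≤ π`. It turns a lower bound for a sum of squared least
residues into an upper bound for the real part of a period. -/
lemma ZMod.re_stdAddChar_le (x : ZMod p) :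
    (ZMod.stdAddChar x).re ≤ 1 - 8 * (x.valMinAbs : ℝ) ^ 2 / (p : ℝ) ^ 2 := by
  have hp : (0 : ℝ) < p := by exact_mod_cast (Fact.out : p.Prime).pos
  have hb : |(x.valMinAbs : ℝ) / p| ≤ 1 / 2 := by
    have h := ZMod.valMinAbs_mem_Ioc x
    have h1 : (-(p : ℝ)) ≤ (x.valMinAbs : ℝ) * 2 := by exact_mod_cast h.1.le
    have h2 : (x.valMinAbs : ℝ) * 2 ≤ p := by exact_mod_cast h.2
    rw [abs_le, le_div_iff₀ hp, div_le_iff₀ hp]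
    constructor <;> linarith
  rw [ZMod.re_stdAddChar]
  refine (Real.cos_le_one_sub_mul_cos_sq ?_).trans (le_of_eq ?_)
  · rw [abs_mul, abs_of_pos (by positivity)]
    nlinarith [Real.pi_pos]
  · have := Real.pi_ne_zero
    field_simp
    ring

/-- The Gaussian period `∑_{h ∈ H} e(bh/p)` of a subgroup `H` of the units modulo `p`. -/
noncomputable def gaussPeriod (H : Subgroup (ZMod p)ˣ) [Fintype H] (b : ZMod p) : ℂ :=
  ∑ h : H, ZMod.stdAddChar (b * ((h : (ZMod p)ˣ) : ZMod p))

variable (H : Subgroup (ZMod p)ˣ) [Fintype H]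

lemma gaussPeriod_zero : gaussPeriod H 0 = Fintype.card H := by
  simp [gaussPeriod]

lemma gaussPeriod_mul_coe (b : ZMod p) (k : H) :
    gaussPeriod H (b * ((k : (ZMod p)ˣ) : ZMod p)) = gaussPeriod H b := by
  unfold gaussPeriod
  refine Fintype.sum_equiv (Equiv.mulLeft k) _ _ fun h => ?_
  simp [mul_assoc]

lemma gaussPeriod_neg (b : ZMod p) : gaussPeriod H (-b) = conj (gaussPeriod H b) := by
  simp [gaussPeriod, ZMod.conj_stdAddChar]

/-- Replacing `h` by `hk` in the double sum of `e(a(h - k)/p)` turns the phase into `ak(h - 1)`, and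
the sum over `k` is again a period. -/
lemma gaussPeriod_mul_conj (a : ZMod p) :
    gaussPeriod H a * conj (gaussPeriod H a) =
      ∑ h : H, gaussPeriod H (a * (((h : (ZMod p)ˣ) : ZMod p) - 1)) := by
  rw [← gaussPeriod_neg]
  unfold gaussPeriod
  rw [Finset.sum_mul_sum, Finset.sum_comm]
  conv_rhs => rw [Finset.sum_comm]
  refine Finset.sum_congr rfl fun k _ => ?_
  refine (Fintype.sum_equiv (Equiv.mulRight k) _ _ fun h => ?_).symm
  rw [← AddChar.map_add_eq_mul]
  congr 1
  simp only [Equiv.coe_mulRight, Subgroup.coe_mul, Units.val_mul]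
  ring

lemma norm_gaussPeriod_sq (a : ZMod p) :
    ‖gaussPeriod H a‖ ^ 2 =
      ∑ h : H, (gaussPeriod H (a * (((h : (ZMod p)ˣ) : ZMod p) - 1))).re := by
  have h := congrArg Complex.re (gaussPeriod_mul_conj H a)
  rwa [Complex.mul_conj, Complex.normSq_eq_norm_sq, Complex.ofReal_re, Complex.re_sum] at h

/-- Parseval's identity for Gaussian periods. -/
lemma sum_norm_gaussPeriod_sq :
    ∑ b : ZMod p, ‖gaussPeriod H b‖ ^ 2 = p * Fintype.card H := by
  classical
  have key : ∑ b : ZMod p, gaussPeriod H b * conj (gaussPeriod H b) =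
      (p : ℂ) * Fintype.card H := by
    simp_rw [gaussPeriod_mul_conj]
    rw [Finset.sum_comm]
    have h1 : ∀ h : H, ∑ b : ZMod p, gaussPeriod H (b * (((h : (ZMod p)ˣ) : ZMod p) - 1)) =
        if h = 1 then (p : ℂ) * Fintype.card H else 0 := by
      intro h
      unfold gaussPeriod
      rw [Finset.sum_comm]
      simp_rw [mul_assoc, AddChar.sum_mulShift _ (ZMod.isPrimitive_stdAddChar p)]
      by_cases hh : h = 1
      · simp [hh, ZMod.card, mul_comm]
      · have : ((h : (ZMod p)ˣ) : ZMod p) - 1 ≠ 0 := by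
          rw [sub_ne_zero]
          intro h'
          exact hh (Subtype.ext (Units.ext h'))
        simp [hh, this]
    simp_rw [h1]
    simp
  have h := congrArg Complex.re key
  rw [Complex.re_sum] at h
  simp_rw [Complex.mul_conj, Complex.normSq_eq_norm_sq, Complex.ofReal_re] at h
  rw [h]
  norm_cast

lemma sum_norm_gaussPeriod_sq_erase_zero :
    ∑ b ∈ Finset.univ.erase (0 : ZMod p), ‖gaussPeriod H b‖ ^ 2 =
      p * Fintype.card H - (Fintype.card H : ℝ) ^ 2 := by
  have h := Finset.add_sum_erase Finset.univ (fun b : ZMod p => ‖gaussPeriod H b‖ ^ 2)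
    (Finset.mem_univ 0)
  rw [sum_norm_gaussPeriod_sq] at h
  simp only [gaussPeriod_zero, Complex.norm_natCast] at h
  linarith

/-- The translates `a h` of a residue class `a` by the elements of `H`. -/
def unitOrbit (a : ZMod p) : Finset (ZMod p) :=
  Finset.univ.image fun h : H => a * ((h : (ZMod p)ˣ) : ZMod p)

lemma mem_unitOrbit {a x : ZMod p} :
    x ∈ unitOrbit H a ↔ ∃ h : H, a * ((h : (ZMod p)ˣ) : ZMod p) = x := by
  simp [unitOrbit]

lemma card_unitOrbit {a : ZMod p} (ha : a ≠ 0) : (unitOrbit H a).card = Fintype.card H := by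
  rw [unitOrbit, Finset.card_image_of_injective, Finset.card_univ]
  intro h k hk
  exact Subtype.ext (Units.ext (mul_left_cancel₀ ha hk))

/-- The period is constant on the `t` elements of `aH`, so `t |η(a)|²` is part of the Parseval total
`pt`. -/
lemma norm_gaussPeriod_le_sqrt {a : ZMod p} (ha : a ≠ 0) : ‖gaussPeriod H a‖ ≤ √p := by
  have hc : (0 : ℝ) < Fintype.card H := by exact_mod_cast Fintype.card_pos
  have h : ∑ b ∈ unitOrbit H a, ‖gaussPeriod H b‖ ^ 2 ≤ p * Fintype.card H := by
    rw [← sum_norm_gaussPeriod_sq H]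
    exact Finset.sum_le_sum_of_subset_of_nonneg (Finset.subset_univ _)
      fun _ _ _ => by positivity
  have h2 : ∑ b ∈ unitOrbit H a, ‖gaussPeriod H b‖ ^ 2 =
      Fintype.card H * ‖gaussPeriod H a‖ ^ 2 := by
    rw [← card_unitOrbit H ha, ← nsmul_eq_mul, ← Finset.sum_const]
    refine Finset.sum_congr rfl fun b hb => ?_
    obtain ⟨k, rfl⟩ := (mem_unitOrbit H).1 hb
    rw [gaussPeriod_mul_coe]
  apply Real.le_sqrt_of_sq_le
  rw [h2] at h
  nlinarith

/-- If the period of every nonzero class has real part at most `t - q`, with `t = |H|`, then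
every period of a nonzero class satisfies `|η|² ≤ t² - (t - 1) q`. -/
lemma norm_gaussPeriod_sq_le {q : ℝ}
    (hq : ∀ b : ZMod p, b ≠ 0 → (gaussPeriod H b).re ≤ Fintype.card H - q)
    {a : ZMod p} (ha : a ≠ 0) :
    ‖gaussPeriod H a‖ ^ 2 ≤ (Fintype.card H : ℝ) ^ 2 - (Fintype.card H - 1) * q := by
  classical
  rw [norm_gaussPeriod_sq, ← Finset.add_sum_erase _ _ (Finset.mem_univ (1 : H))]
  have h1 : ∑ h ∈ Finset.univ.erase (1 : H),
      (gaussPeriod H (a * (((h : (ZMod p)ˣ) : ZMod p) - 1))).re ≤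
      ((Finset.univ.erase (1 : H)).card : ℝ) * (Fintype.card H - q) := by
    rw [← nsmul_eq_mul]
    refine Finset.sum_le_card_nsmul _ _ _ fun h hh => hq _ (mul_ne_zero ha ?_)
    rw [sub_ne_zero]
    intro h'
    exact Finset.ne_of_mem_erase hh (Subtype.ext (Units.ext h'))
  rw [Finset.card_erase_of_mem (Finset.mem_univ _), Finset.card_univ,
    Nat.cast_sub Fintype.card_pos] at h1
  simp [gaussPeriod_zero] at h1 ⊢
  linarith

end Periods

/-! ### Propagation of large periods to sumsets -/

section Growth

variable {p : ℕ} [Fact p.Prime] (H : Subgroup (ZMod p)ˣ) [Fintype H]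

/-- The `ℓ²` distance of the vector `(e(xh/p))_{h ∈ H}` from the constant vector `ω`. -/
noncomputable def phaseDist (ω : ℂ) (x : ZMod p) : ℝ :=
  ‖(WithLp.toLp 2 fun h : H =>
    ZMod.stdAddChar (x * ((h : (ZMod p)ˣ) : ZMod p)) - ω : EuclideanSpace ℂ H)‖

lemma phaseDist_nonneg (ω : ℂ) (x : ZMod p) : 0 ≤ phaseDist H ω x := norm_nonneg _

/-- The deficit of a period in the direction `ω` is half a squared distance. Distances grow linearly
under addition, so deficits grow quadratically. -/
lemma phaseDist_sq {ω : ℂ} (hω : ‖ω‖ = 1) (x : ZMod p) :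
    phaseDist H ω x ^ 2 = 2 * (Fintype.card H - (conj ω * gaussPeriod H x).re) := by
  rw [phaseDist, EuclideanSpace.norm_sq_eq]
  have h1 : ∀ z : ℂ, ‖z‖ = 1 → ‖z - ω‖ ^ 2 = 2 - 2 * (conj ω * z).re := by
    intro z hz
    have hz2 : ‖z‖ ^ 2 = 1 := by rw [hz]; norm_num
    have hω2 : ‖ω‖ ^ 2 = 1 := by rw [hω]; norm_num
    rw [← Complex.normSq_eq_norm_sq, Complex.normSq_apply] at *
    simp only [Complex.sub_re, Complex.sub_im, Complex.mul_re, Complex.conj_re, Complex.conj_im]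
    linarith
  simp only [h1 _ (ZMod.norm_stdAddChar _)]
  rw [Finset.sum_sub_distrib, ← Finset.mul_sum, ← Complex.re_sum, ← Finset.mul_sum, gaussPeriod]
  simp
  ring

/-- Triangle inequality for `zw - ωω' = ω'(z - ω) + z(w - ω')`, where the factors `ω'` and `z` have
modulus 1. -/
lemma phaseDist_add_le (ω : ℂ) {ω' : ℂ} (hω' : ‖ω'‖ = 1) (x y : ZMod p) :
    phaseDist H (ω * ω') (x + y) ≤ phaseDist H ω x + phaseDist H ω' y := by
  have hsplit : (WithLp.toLp 2 fun h : H =>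
      ZMod.stdAddChar ((x + y) * ((h : (ZMod p)ˣ) : ZMod p)) - ω * ω' : EuclideanSpace ℂ H) =
      (WithLp.toLp 2 fun h : H =>
        ω' * (ZMod.stdAddChar (x * ((h : (ZMod p)ˣ) : ZMod p)) - ω) : EuclideanSpace ℂ H) +
      WithLp.toLp 2 fun h : H => ZMod.stdAddChar (x * ((h : (ZMod p)ˣ) : ZMod p)) *
        (ZMod.stdAddChar (y * ((h : (ZMod p)ˣ) : ZMod p)) - ω') := by
    ext h
    simp only [PiLp.add_apply]
    rw [add_mul, AddChar.map_add_eq_mul]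
    ring
  rw [phaseDist, hsplit]
  refine (norm_add_le _ _).trans (le_of_eq ?_)
  congr 1
  · rw [phaseDist, EuclideanSpace.norm_eq, EuclideanSpace.norm_eq]
    simp [hω']
  · rw [phaseDist, EuclideanSpace.norm_eq, EuclideanSpace.norm_eq]
    simp

/-- If every element of `B` is at distance at most `r` from a constant vector with value in a
set `S` of unit complex numbers, then every sum of `k` elements of `B` is at distance at most
`k r` from a constant vector with value a product of `k` elements of `S`. -/
lemma phaseDist_nsmul_le {B : Finset (ZMod p)} {S : Set ℂ} {r : ℝ} (hS : ∀ ω ∈ S, ‖ω‖ = 1)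
    (hB : ∀ x ∈ B, ∃ ω ∈ S, phaseDist H ω x ≤ r) (k : ℕ) :
    ∀ x ∈ k • B, ∃ ω ∈ S ^ k, phaseDist H ω x ≤ k * r := by
  induction k with
  | zero =>
    intro x hx
    rw [zero_nsmul, Finset.mem_zero] at hx
    refine ⟨1, by simp, ?_⟩
    simp [hx, phaseDist, EuclideanSpace.norm_eq]
  | succ k ih =>
    intro x hx
    rw [succ_nsmul, Finset.mem_add] at hx
    obtain ⟨y, hy, z, hz, rfl⟩ := hx
    obtain ⟨ω, hω, h1⟩ := ih y hy
    obtain ⟨ω', hω', h2⟩ := hB z hz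
    refine ⟨ω * ω', by rw [pow_succ]; exact Set.mul_mem_mul hω hω', ?_⟩
    have := phaseDist_add_le H ω (hS _ hω') y z
    push_cast
    linarith

lemma norm_eq_one_of_mem_pow {S : Set ℂ} (hS : ∀ ω ∈ S, ‖ω‖ = 1) (k : ℕ) :
    ∀ ω ∈ S ^ k, ‖ω‖ = 1 := by
  induction k with
  | zero => intro ω hω; simp_all
  | succ k ih =>
    intro ω hω
    rw [pow_succ] at hω
    obtain ⟨a, ha, b, hb, rfl⟩ := hω
    simp [ih a ha, hS b hb]

/-- The iterated Cauchy–Davenport inequality. -/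
lemma ZMod.card_nsmul_ge {B : Finset (ZMod p)} (hB : B.Nonempty) (k : ℕ) :
    min p (k * (B.card - 1) + 1) ≤ (k • B).card := by
  induction k with
  | zero => simp
  | succ k ih =>
    rw [succ_nsmul]
    have h := ZMod.cauchy_davenport (Fact.out : p.Prime) (hB.nsmul (n := k)) hB
    have hc := hB.card_pos
    have : (k + 1) * (B.card - 1) = k * (B.card - 1) + (B.card - 1) := by ring
    omega

/-- A weighted count: if for each `k ≤ K` at least `k c` elements have weight at least `u k`,
then the total weight is at least `c ∑ u k`. -/
lemma exists_card_and_le_sum {ι : Type*} [DecidableEq ι] {X : Finset ι} {w : ι → ℝ}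
    {u : ℕ → ℝ} {c K : ℕ}
    (h : ∀ k, 1 ≤ k → k ≤ K → ∃ A ⊆ X, k * c ≤ A.card ∧ ∀ x ∈ A, u k ≤ w x) :
    ∃ B ⊆ X, B.card = K * c ∧ c * ∑ k ∈ Finset.Icc 1 K, u k ≤ ∑ x ∈ B, w x := by
  induction K with
  | zero => exact ⟨∅, by simp⟩
  | succ K ih =>
    obtain ⟨B, hBX, hBc, hB⟩ := ih fun k h1 h2 => h k h1 (h2.trans K.le_succ)
    -- Only `K c` elements are used so far, so the next set still has `c` fresh ones.
    obtain ⟨A, hAX, hAc, hA⟩ := h (K + 1) (by omega) le_rfl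
    have hle : c ≤ (A \ B).card := by
      have := Finset.le_card_sdiff B A
      rw [add_mul] at hAc
      omega
    obtain ⟨C, hCA, hC⟩ := Finset.exists_subset_card_eq hle
    have hdisj : Disjoint B C :=
      (Finset.disjoint_sdiff (s := B) (t := A)).mono_right hCA
    refine ⟨B ∪ C, Finset.union_subset hBX
      ((hCA.trans Finset.sdiff_subset).trans hAX), ?_, ?_⟩
    · rw [Finset.card_union_of_disjoint hdisj, hBc, hC]; ring
    · rw [Finset.sum_union hdisj, Finset.sum_Icc_succ_top (by omega), mul_add]
      refine add_le_add hB ?_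
      rw [← hC, ← nsmul_eq_mul]
      exact Finset.card_nsmul_le_sum _ _ _ fun x hx =>
        hA x (Finset.mem_sdiff.1 (hCA hx)).1

lemma le_sum_of_forall_exists {ι : Type*} [DecidableEq ι] {X : Finset ι} {w : ι → ℝ}
    (hw : ∀ x, 0 ≤ w x) {u : ℕ → ℝ} {c K : ℕ}
    (h : ∀ k, 1 ≤ k → k ≤ K → ∃ A ⊆ X, k * c ≤ A.card ∧ ∀ x ∈ A, u k ≤ w x) :
    c * ∑ k ∈ Finset.Icc 1 K, u k ≤ ∑ x ∈ X, w x := by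
  obtain ⟨B, hBX, -, hB⟩ := exists_card_and_le_sum h
  exact hB.trans (Finset.sum_le_sum_of_subset_of_nonneg hBX fun _ _ _ => hw _)

end Growth

/-! ### Counting large periods against Parseval -/

section Counting

variable {p : ℕ} [Fact p.Prime] (H : Subgroup (ZMod p)ˣ) [Fintype H]

lemma le_re_of_mem_nsmul {B : Finset (ZMod p)} {S : Set ℂ} {X : ℝ} (hX : 0 ≤ X)
    (hS : ∀ ω ∈ S, ‖ω‖ = 1)
    (hB : ∀ x ∈ B, ∃ ω ∈ S, Fintype.card H - X ≤ (conj ω * gaussPeriod H x).re) (k : ℕ) :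
    ∀ x ∈ k • B, ∃ ω ∈ S ^ k, Fintype.card H - k ^ 2 * X ≤ (conj ω * gaussPeriod H x).re := by
  intro x hx
  obtain ⟨ω, hω, h⟩ := phaseDist_nsmul_le H (r := √(2 * X)) hS (fun y hy => by
    obtain ⟨ω, hω, h⟩ := hB y hy
    refine ⟨ω, hω, Real.le_sqrt_of_sq_le ?_⟩
    rw [phaseDist_sq H (hS ω hω)]
    linarith) k x hx
  refine ⟨ω, hω, ?_⟩
  have h2 := pow_le_pow_left₀ (phaseDist_nonneg H ω x) h 2
  rw [phaseDist_sq H (norm_eq_one_of_mem_pow hS k ω hω), mul_pow,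
    Real.sq_sqrt (by positivity)] at h2
  linarith

/-- The `+ 1` in Cauchy–Davenport pays for discarding `0`, whose period is trivially `t`. -/
lemma le_card_erase_zero_nsmul {B : Finset (ZMod p)} (hB : B.Nonempty) {k : ℕ}
    (hk : k * (B.card - 1) + 1 ≤ p) : k * (B.card - 1) ≤ ((k • B).erase 0).card := by
  have h := ZMod.card_nsmul_ge hB k
  have := Finset.pred_card_le_card_erase (s := k • B) (a := 0)
  omega

lemma unitOrbit_nonempty (a : ZMod p) : (unitOrbit H a).Nonempty :=
  ⟨a, (mem_unitOrbit H).2 ⟨1, by simp⟩⟩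

lemma exists_phase (z : ℂ) : ∃ ω : ℂ, ‖ω‖ = 1 ∧ (conj ω * z).re = ‖z‖ := by
  by_cases hz : z = 0
  · exact ⟨1, by simp [hz]⟩
  · have hn : (‖z‖ : ℂ) ≠ 0 := by simpa using hz
    refine ⟨z / ‖z‖, by simp [hz], ?_⟩
    have : conj (z / ‖z‖) * z = ((‖z‖ : ℝ) : ℂ) := by
      rw [map_div₀, Complex.conj_ofReal, div_mul_eq_mul_div, mul_comm, Complex.mul_conj,
        Complex.normSq_eq_norm_sq]
      field_simp
      push_cast
      ring
    rw [this, Complex.ofReal_re]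

lemma sum_le_of_phases {B : Finset (ZMod p)} (hBn : B.Nonempty) {X : ℝ} (hX : 0 ≤ X)
    (hB : ∀ x ∈ B, Fintype.card H - X ≤ ‖gaussPeriod H x‖) {K : ℕ}
    (hK : K * (B.card - 1) + 1 ≤ p) :
    ((B.card - 1 : ℕ) : ℝ) * ∑ k ∈ Finset.Icc 1 K, max 0 (Fintype.card H - (k : ℝ) ^ 2 * X) ^ 2 ≤
      p * Fintype.card H - (Fintype.card H : ℝ) ^ 2 := by
  classical
  rw [← sum_norm_gaussPeriod_sq_erase_zero H]
  refine le_sum_of_forall_exists (fun _ => by positivity) fun k _ hkK =>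
    ⟨(k • B).erase 0, Finset.erase_subset_erase _ (Finset.subset_univ _),
      le_card_erase_zero_nsmul hBn (le_trans (by gcongr) hK), fun x hx => ?_⟩
  obtain ⟨ω, hω, h⟩ := le_re_of_mem_nsmul H (S := {ω | ‖ω‖ = 1}) hX (fun _ h => h)
    (fun y hy => by
      obtain ⟨ω, h1, h2⟩ := exists_phase (gaussPeriod H y)
      exact ⟨ω, h1, by rw [h2]; exact hB y hy⟩) k x (Finset.mem_of_mem_erase hx)
  have hn := norm_eq_one_of_mem_pow (fun _ h => h) k ω hω
  have h3 : (conj ω * gaussPeriod H x).re ≤ ‖gaussPeriod H x‖ := by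
    refine (Complex.re_le_norm _).trans (le_of_eq ?_)
    rw [norm_mul, Complex.norm_conj, hn, one_mul]
  gcongr
  exact max_le (norm_nonneg _) (h.trans h3)

/-- A large Gaussian period forces many large Gaussian periods, within the bound given by
Parseval's identity. -/
lemma sum_le_of_norm_gaussPeriod_ge {a : ZMod p} (ha : a ≠ 0) {X : ℝ} (hX : 0 ≤ X)
    (haX : Fintype.card H - X ≤ ‖gaussPeriod H a‖) {K : ℕ}
    (hK : K * Fintype.card H + 1 ≤ p) :
    ((Fintype.card H : ℝ) - 1) *
        ∑ k ∈ Finset.Icc 1 K, max 0 (Fintype.card H - (k : ℝ) ^ 2 * X) ^ 2 ≤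
      p * Fintype.card H - (Fintype.card H : ℝ) ^ 2 := by
  have hc := card_unitOrbit H ha
  have h := sum_le_of_phases H (unitOrbit_nonempty H a) hX (fun x hx => by
    obtain ⟨k, rfl⟩ := (mem_unitOrbit H).1 hx
    rwa [gaussPeriod_mul_coe]) (K := K) (le_trans (by rw [hc]; gcongr; omega) hK)
  rwa [hc, Nat.cast_sub Fintype.card_pos, Nat.cast_one] at h

/-- Since `η(-a)` is the conjugate of `η(a)`, the set `aH ∪ -aH` serves as base set; the union is
disjoint because `-1 ∉ H`. -/
lemma two_mul_sum_le_of_neg_one_notMem {a : ZMod p} (ha : a ≠ 0) {X : ℝ} (hX : 0 ≤ X)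
    (haX : Fintype.card H - X ≤ ‖gaussPeriod H a‖) (hneg : (-1 : (ZMod p)ˣ) ∉ H) {K : ℕ}
    (hK : 2 * K * Fintype.card H + 1 ≤ p) :
    (2 * Fintype.card H - 1 : ℝ) *
        ∑ k ∈ Finset.Icc 1 K, max 0 (Fintype.card H - (k : ℝ) ^ 2 * X) ^ 2 ≤
      p * Fintype.card H - (Fintype.card H : ℝ) ^ 2 := by
  have hdisj : Disjoint (unitOrbit H a) (unitOrbit H (-a)) := by
    rw [Finset.disjoint_left]
    intro x h1 h2
    obtain ⟨h, rfl⟩ := (mem_unitOrbit H).1 h1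
    obtain ⟨k, hk⟩ := (mem_unitOrbit H).1 h2
    apply hneg
    have h3 : -((k : (ZMod p)ˣ) : ZMod p) = ((h : (ZMod p)ˣ) : ZMod p) := by
      apply mul_left_cancel₀ ha
      rw [← hk]; ring
    have h4 : (-1 : (ZMod p)ˣ) = h * (k : (ZMod p)ˣ)⁻¹ := by
      rw [eq_mul_inv_iff_mul_eq]
      ext
      rw [Units.val_mul, Units.val_neg, Units.val_one, neg_one_mul, h3]
    rw [h4]
    exact H.mul_mem h.2 (H.inv_mem k.2)
  have hc : (unitOrbit H a ∪ unitOrbit H (-a)).card = 2 * Fintype.card H := by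
    rw [Finset.card_union_of_disjoint hdisj, card_unitOrbit H ha,
      card_unitOrbit H (neg_ne_zero.2 ha), two_mul]
  have hpos : 0 < Fintype.card H := Fintype.card_pos
  have h := sum_le_of_phases H (B := unitOrbit H a ∪ unitOrbit H (-a))
    ((unitOrbit_nonempty H a).mono Finset.subset_union_left) hX (fun x hx => by
      rcases Finset.mem_union.1 hx with hx | hx <;>
      · obtain ⟨k, rfl⟩ := (mem_unitOrbit H).1 hx
        simpa [gaussPeriod_mul_coe, gaussPeriod_neg] using haX) (K := K)
    (le_trans (by
      rw [hc, show 2 * K * Fintype.card H = K * (2 * Fintype.card H) by ring]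
      gcongr
      omega) hK)
  rw [hc, Nat.cast_sub (by omega)] at h
  push_cast at h
  exact h

lemma sum_Icc_two_mul_add_one (f : ℕ → ℝ) (K : ℕ) :
    ∑ k ∈ Finset.Icc 2 (2 * K + 1), f k =
      ∑ j ∈ Finset.Icc 1 K, (f (2 * j) + f (2 * j + 1)) := by
  induction K with
  | zero => simp
  | succ K ih =>
    rw [show 2 * (K + 1) + 1 = 2 * K + 1 + 1 + 1 by ring, Finset.sum_Icc_succ_top (by omega),
      Finset.sum_Icc_succ_top (by omega), ih, Finset.sum_Icc_succ_top (by omega),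
      show 2 * (K + 1) = 2 * K + 1 + 1 by ring]
    ring

/-- With the constant phase `-1`, the `k`-fold sums have phase `(-1)^k`. Even and odd layers thus
feed the positive and the negative part of `Re η`, whose squares are counted separately; each parity
steps by `2(t - 1)`. -/
lemma two_mul_sum_le_of_re_neg {a : ZMod p} (ha : a ≠ 0) {X : ℝ} (hX : 0 ≤ X)
    (haX : Fintype.card H - X ≤ -(gaussPeriod H a).re) {K : ℕ}
    (hK : (2 * K + 1) * Fintype.card H + 1 ≤ p) :
    2 * ((Fintype.card H : ℝ) - 1) *
        ∑ k ∈ Finset.Icc 2 (2 * K + 1), max 0 (Fintype.card H - (k : ℝ) ^ 2 * X) ^ 2 ≤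
      p * Fintype.card H - (Fintype.card H : ℝ) ^ 2 := by
  classical
  set t := Fintype.card H with ht
  have ht1 : 1 ≤ t := Fintype.card_pos
  have hc : (unitOrbit H a).card = t := card_unitOrbit H ha
  have hsub : ∀ k : ℕ, (k • unitOrbit H a).erase 0 ⊆ Finset.univ.erase (0 : ZMod p) := fun k =>
    Finset.erase_subset_erase _ (Finset.subset_univ _)
  have hcard : ∀ k : ℕ, k ≤ 2 * K + 1 → k * (t - 1) ≤ ((k • unitOrbit H a).erase 0).card := by
    intro k hk
    have h := le_card_erase_zero_nsmul (k := k) (unitOrbit_nonempty H a)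
      (le_trans (by rw [hc]; gcongr; omega) hK)
    rwa [hc] at h
  have hre : ∀ k : ℕ, ∀ x ∈ (k • unitOrbit H a).erase 0,
      (t : ℝ) - (k : ℝ) ^ 2 * X ≤ (-1) ^ k * (gaussPeriod H x).re := by
    intro k x hx
    obtain ⟨ω, hω, h⟩ := le_re_of_mem_nsmul H (S := {-1}) hX (by simp) (fun y hy => by
      obtain ⟨k, rfl⟩ := (mem_unitOrbit H).1 hy
      exact ⟨-1, rfl, by simpa [gaussPeriod_mul_coe] using haX⟩) k x (Finset.mem_of_mem_erase hx)
    have hω' : ω = (((-1 : ℝ) ^ k : ℝ) : ℂ) := by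
      rw [Set.singleton_pow, Set.mem_singleton_iff] at hω
      rw [hω]; push_cast; rfl
    rwa [hω', Complex.conj_ofReal, Complex.re_ofReal_mul] at h
  have heven := le_sum_of_forall_exists (X := Finset.univ.erase (0 : ZMod p))
    (w := fun x => max 0 (gaussPeriod H x).re ^ 2) (fun _ => by positivity)
    (u := fun j => max 0 ((t : ℝ) - ((2 * j : ℕ) : ℝ) ^ 2 * X) ^ 2) (c := 2 * (t - 1)) (K := K)
    fun j _ hj => ⟨_, hsub (2 * j), by
      refine le_trans (le_of_eq ?_) (hcard (2 * j) (by omega)); ring, fun x hx => by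
        have h := hre _ x hx
        rw [pow_mul (-1 : ℝ), neg_one_sq, one_pow, one_mul] at h
        gcongr⟩
  have hodd := le_sum_of_forall_exists (X := Finset.univ.erase (0 : ZMod p))
    (w := fun x => max 0 (-(gaussPeriod H x).re) ^ 2) (fun _ => by positivity)
    (u := fun j => max 0 ((t : ℝ) - ((2 * j + 1 : ℕ) : ℝ) ^ 2 * X) ^ 2)
    (c := 2 * (t - 1)) (K := K)
    fun j _ hj => ⟨_, hsub (2 * j + 1), by
      refine le_trans ?_ (hcard (2 * j + 1) (by omega))
      rw [← mul_assoc]; gcongr; omega, fun x hx => by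
        have h := hre _ x hx
        rw [pow_succ (-1 : ℝ), pow_mul (-1 : ℝ), neg_one_sq, one_pow, one_mul, neg_one_mul] at h
        gcongr⟩
  have hsum : ∀ x : ZMod p, max 0 (gaussPeriod H x).re ^ 2 +
      max 0 (-(gaussPeriod H x).re) ^ 2 ≤ ‖gaussPeriod H x‖ ^ 2 := by
    intro x
    have h1 : (gaussPeriod H x).re ^ 2 ≤ ‖gaussPeriod H x‖ ^ 2 := by
      rw [← sq_abs]
      exact pow_le_pow_left₀ (abs_nonneg _) (Complex.abs_re_le_norm _) 2
    rcases le_total 0 (gaussPeriod H x).re with h0 | h0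
    · rw [max_eq_right h0, max_eq_left (by linarith)]; linarith
    · rw [max_eq_left h0, max_eq_right (by linarith)]; linarith
  have htot := Finset.sum_le_sum fun x (_ : x ∈ Finset.univ.erase (0 : ZMod p)) => hsum x
  rw [Finset.sum_add_distrib, sum_norm_gaussPeriod_sq_erase_zero H] at htot
  rw [sum_Icc_two_mul_add_one, Finset.sum_add_distrib]
  rw [Nat.cast_mul, Nat.cast_sub ht1] at heven hodd
  push_cast at heven hodd htot ⊢
  linarith

/-- If the period of `a` is large, but not a positive real number with `H = -H`, then there are
twice as many large Gaussian periods. -/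
lemma two_mul_sum_le {a : ZMod p} (ha : a ≠ 0) {X : ℝ} (hX : 0 ≤ X)
    (haX : Fintype.card H - X ≤ ‖gaussPeriod H a‖)
    (hnot : ¬ (gaussPeriod H a).re = ‖gaussPeriod H a‖) {K : ℕ} (hK0 : 1 ≤ K)
    (hK : (2 * K + 1) * Fintype.card H + 1 ≤ p) :
    2 * ((Fintype.card H : ℝ) - 1) *
        (∑ k ∈ Finset.Icc 1 K, max 0 (Fintype.card H - (k : ℝ) ^ 2 * X) ^ 2 -
          (Fintype.card H : ℝ) ^ 2) ≤
      p * Fintype.card H - (Fintype.card H : ℝ) ^ 2 := by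
  set t := Fintype.card H with ht
  have ht1 : (1 : ℝ) ≤ t := by exact_mod_cast (Fintype.card_pos : 0 < Fintype.card H)
  have hnn : ∀ s : Finset ℕ, 0 ≤ ∑ k ∈ s, max 0 ((t : ℝ) - (k : ℝ) ^ 2 * X) ^ 2 := fun s =>
    Finset.sum_nonneg fun _ _ => by positivity
  by_cases hneg : (-1 : (ZMod p)ˣ) ∈ H
  · have hconj : conj (gaussPeriod H a) = gaussPeriod H a := by
      rw [← gaussPeriod_neg]
      simpa using gaussPeriod_mul_coe H a ⟨-1, hneg⟩
    have hre : (((gaussPeriod H a).re : ℝ) : ℂ) = gaussPeriod H a := Complex.conj_eq_iff_re.1 hconj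
    have hre' : -(gaussPeriod H a).re = ‖gaussPeriod H a‖ := by
      have : ‖gaussPeriod H a‖ = |(gaussPeriod H a).re| := by
        rw [← Real.norm_eq_abs, ← Complex.norm_real, hre]
      rcases abs_choice (gaussPeriod H a).re with h | h
      · exact absurd (this.trans h).symm hnot
      · rw [this, h]
    refine le_trans ?_ (two_mul_sum_le_of_re_neg H ha hX (by rw [hre']; exact haX) hK)
    refine mul_le_mul_of_nonneg_left ?_ (by linarith)
    rw [← ht]
    -- The parity argument starts at `k = 2`; the missing term `k = 1` costs at most `t²`.
    have h1 : max 0 ((t : ℝ) - ((1 : ℕ) : ℝ) ^ 2 * X) ^ 2 ≤ (t : ℝ) ^ 2 := by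
      gcongr
      refine max_le (by positivity) ?_
      push_cast
      linarith
    have h2 : Finset.Icc 1 K = insert 1 (Finset.Icc 2 K) := by
      ext x; simp; omega
    rw [h2, Finset.sum_insert (by simp)]
    have h3 : ∑ k ∈ Finset.Icc 2 K, max 0 ((t : ℝ) - (k : ℝ) ^ 2 * X) ^ 2 ≤
        ∑ k ∈ Finset.Icc 2 (2 * K + 1), max 0 ((t : ℝ) - (k : ℝ) ^ 2 * X) ^ 2 :=
      Finset.sum_le_sum_of_subset_of_nonneg (Finset.Icc_subset_Icc le_rfl (by omega))
        fun _ _ _ => by positivity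
    linarith
  · refine le_trans ?_ (two_mul_sum_le_of_neg_one_notMem H ha hX haX hneg (K := K)
      (le_trans (by gcongr; omega) hK))
    have h1 := hnn (Finset.Icc 1 K)
    have h2 : (0 : ℝ) ≤ (t - 1) * (t : ℝ) ^ 2 :=
      mul_nonneg (by linarith) (by positivity)
    rw [← ht]
    linarith

lemma sum_Icc_sq (K : ℕ) :
    ∑ k ∈ Finset.Icc 1 K, (k : ℝ) ^ 2 = K * (K + 1) * (2 * K + 1) / 6 := by
  induction K with
  | zero => simp
  | succ K ih => rw [Finset.sum_Icc_succ_top (by omega), ih]; push_cast; ring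

lemma sum_Icc_pow_four (K : ℕ) :
    ∑ k ∈ Finset.Icc 1 K, (k : ℝ) ^ 4 =
      K * (K + 1) * (2 * K + 1) * (3 * K ^ 2 + 3 * K - 1) / 30 := by
  induction K with
  | zero => simp
  | succ K ih => rw [Finset.sum_Icc_succ_top (by omega), ih]; push_cast; ring

/-- Since `X ≤ T/K²`, the sum dominates `T² ∑ (1 - (k/K)²)²`, a Riemann sum for `K ∫₀¹ (1 - u²)² du
= 8K/15`; the `- 1` absorbs the error. -/
lemma le_sum_max_sq {T X : ℝ} (hX : 0 ≤ X) {K : ℕ} (hK : 1 ≤ K) (hKX : (K : ℝ) ^ 2 * X ≤ T) :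
    8 / 15 * ((K : ℝ) - 1) * T ^ 2 ≤
      ∑ k ∈ Finset.Icc 1 K, max 0 (T - (k : ℝ) ^ 2 * X) ^ 2 := by
  have hK0 : (1 : ℝ) ≤ K := by exact_mod_cast hK
  have hT : 0 ≤ T := le_trans (by positivity) hKX
  have h1 : ∑ k ∈ Finset.Icc 1 K, (T * (1 - (k : ℝ) ^ 2 / (K : ℝ) ^ 2)) ^ 2 ≤
      ∑ k ∈ Finset.Icc 1 K, max 0 (T - (k : ℝ) ^ 2 * X) ^ 2 := by
    refine Finset.sum_le_sum fun k hk => ?_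
    have hk' : (k : ℝ) ≤ K := by exact_mod_cast (Finset.mem_Icc.1 hk).2
    refine pow_le_pow_left₀ (mul_nonneg hT ?_) (le_max_of_le_right ?_) 2
    · rw [sub_nonneg, div_le_one (by positivity)]
      gcongr
    · have : X ≤ T / (K : ℝ) ^ 2 := by rw [le_div_iff₀ (by positivity)]; linarith
      have h3 := mul_le_mul_of_nonneg_left this (sq_nonneg (k : ℝ))
      calc T * (1 - (k : ℝ) ^ 2 / (K : ℝ) ^ 2) = T - (k : ℝ) ^ 2 * (T / (K : ℝ) ^ 2) := by ring
        _ ≤ _ := by linarith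
  refine le_trans ?_ h1
  have h2 : ∑ k ∈ Finset.Icc 1 K, (T * (1 - (k : ℝ) ^ 2 / (K : ℝ) ^ 2)) ^ 2 =
      T ^ 2 * (K - 2 * (∑ k ∈ Finset.Icc 1 K, (k : ℝ) ^ 2) / (K : ℝ) ^ 2 +
        (∑ k ∈ Finset.Icc 1 K, (k : ℝ) ^ 4) / (K : ℝ) ^ 4) := by
    have : ∀ k : ℕ, (T * (1 - (k : ℝ) ^ 2 / (K : ℝ) ^ 2)) ^ 2 =
      T ^ 2 * (1 - 2 * (k : ℝ) ^ 2 / (K : ℝ) ^ 2 + (k : ℝ) ^ 4 / (K : ℝ) ^ 4) := fun k => by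
        field_simp
        ring
    simp_rw [this]
    rw [← Finset.mul_sum, Finset.sum_add_distrib, Finset.sum_sub_distrib, ← Finset.sum_div,
      ← Finset.sum_div, ← Finset.mul_sum]
    simp
  rw [h2, sum_Icc_sq, sum_Icc_pow_four, mul_comm]
  gcongr
  have h3 : (K : ℝ) - 2 * (K * (K + 1) * (2 * K + 1) / 6) / (K : ℝ) ^ 2 +
      K * (K + 1) * (2 * K + 1) * (3 * K ^ 2 + 3 * K - 1) / 30 / (K : ℝ) ^ 4 =
      8 / 15 * K - 1 / 2 - 1 / 30 * (1 / (K : ℝ) ^ 3) := by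
    field_simp
    ring
  rw [h3]
  have h4 : 1 / (K : ℝ) ^ 3 ≤ 1 := by
    rw [div_le_one (by positivity)]
    exact one_le_pow₀ hK0
  linarith

end Counting

/-! ### The subgroup of `d`-th powers and its cosets -/

section PowerSubgroup

variable {p : ℕ} [Fact p.Prime]

lemma expE_intCast_div (m : ℤ) : expE ((m : ℝ) / (p : ℝ)) = ZMod.stdAddChar (m : ZMod p) := by
  rw [ZMod.stdAddChar_coe, expE]
  congr 1
  push_cast
  ring

lemma sum_range_eq_sum_zmod (F : ZMod p → ℂ) :
    ∑ x ∈ Finset.range p, F x = ∑ x : ZMod p, F x := by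
  refine Finset.sum_nbij' (fun x => (x : ZMod p)) ZMod.val (by simp)
    (fun x _ => Finset.mem_range.2 (ZMod.val_lt x)) (fun x hx => ?_) (by simp) (by simp)
  exact ZMod.val_cast_of_lt (Finset.mem_range.1 hx)

lemma sum_zmod_eq_add_sum_units (F : ZMod p → ℂ) :
    ∑ x : ZMod p, F x = F 0 + ∑ u : (ZMod p)ˣ, F u := by
  classical
  rw [← Finset.add_sum_erase _ _ (Finset.mem_univ 0)]
  congr 1
  refine (Finset.sum_nbij (fun u : (ZMod p)ˣ => (u : ZMod p)) (by simp)
    (fun _ _ _ _ h => Units.ext h) (fun x hx => ?_) (by simp)).symm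
  have hx0 : x ≠ 0 := by simpa using hx
  exact ⟨Units.mk0 x hx0, by simp⟩

lemma card_powMonoidHom_range [IsCyclic (ZMod p)ˣ] {d : ℕ} (hd : d ∣ p - 1)
    [Fintype (powMonoidHom d : (ZMod p)ˣ →* (ZMod p)ˣ).range] :
    Fintype.card (powMonoidHom d : (ZMod p)ˣ →* (ZMod p)ˣ).range = (p - 1) / d := by
  rw [← Nat.card_eq_fintype_card, IsCyclic.card_powMonoidHom_range, Nat.card_eq_fintype_card,
    ZMod.card_units, Nat.gcd_eq_right hd]

lemma sum_units_pow [IsCyclic (ZMod p)ˣ] {d : ℕ} (hd : d ∣ p - 1)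
    [Fintype (powMonoidHom d : (ZMod p)ˣ →* (ZMod p)ˣ).range] (F : (ZMod p)ˣ → ℂ) :
    ∑ u : (ZMod p)ˣ, F (u ^ d) =
      d * ∑ h : (powMonoidHom d : (ZMod p)ˣ →* (ZMod p)ˣ).range, F h := by
  classical
  have hfib : ∀ h : (powMonoidHom d : (ZMod p)ˣ →* (ZMod p)ˣ).range,
      (Finset.univ.filter fun u : (ZMod p)ˣ => u ^ d = h).card = d := by
    intro h
    have h1 := MonoidHom.card_fiber_eq_of_mem_range (powMonoidHom d : (ZMod p)ˣ →* (ZMod p)ˣ)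
      (x := (h : (ZMod p)ˣ)) (y := 1) h.2 ⟨1, by simp⟩
    simp only [powMonoidHom_apply] at h1
    rw [h1]
    have h2 := IsCyclic.card_powMonoidHom_ker (G := (ZMod p)ˣ) d
    rw [Nat.card_eq_fintype_card (α := (ZMod p)ˣ), ZMod.card_units, Nat.gcd_eq_right hd] at h2
    refine Eq.trans ?_ h2
    rw [Nat.card_eq_fintype_card, Fintype.card_of_subtype
      (Finset.univ.filter fun u : (ZMod p)ˣ => u ^ d = 1) (by simp [MonoidHom.mem_ker])]
  rw [Finset.mul_sum, ← Finset.sum_fiberwise (s := Finset.univ)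
    (g := fun u : (ZMod p)ˣ => (⟨u ^ d, u, rfl⟩ :
      (powMonoidHom d : (ZMod p)ˣ →* (ZMod p)ˣ).range))]
  refine Finset.sum_congr rfl fun h _ => ?_
  have h3 : ∀ u ∈ Finset.univ.filter (fun u : (ZMod p)ˣ => (⟨u ^ d, u, rfl⟩ :
      (powMonoidHom d : (ZMod p)ˣ →* (ZMod p)ˣ).range) = h), F (u ^ d) = F h := by
    intro u hu
    rw [← (Finset.mem_filter.1 hu).2]
  rw [Finset.sum_congr rfl h3, Finset.sum_const, nsmul_eq_mul]
  congr 2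
  refine (congrArg Finset.card ?_).trans (hfib h)
  ext u
  simp [Subtype.ext_iff]

/-- A complete monomial exponential sum in terms of a Gaussian period. -/
lemma gaussS_eq_gaussPeriod [IsCyclic (ZMod p)ˣ] {d : ℕ} (hd : d ∣ p - 1) (hd0 : d ≠ 0)
    [Fintype (powMonoidHom d : (ZMod p)ˣ →* (ZMod p)ˣ).range] (a : ℤ) :
    gaussS d p a = 1 + d * gaussPeriod (powMonoidHom d : (ZMod p)ˣ →* (ZMod p)ˣ).range a := by
  have h1 : gaussS d p a = ∑ x ∈ Finset.range p,
      (fun z : ZMod p => ZMod.stdAddChar ((a : ZMod p) * z ^ d)) (x : ZMod p) := by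
    refine Finset.sum_congr rfl fun x _ => ?_
    have := expE_intCast_div (p := p) (a * (x : ℤ) ^ d)
    push_cast at this
    exact this
  rw [h1, sum_range_eq_sum_zmod fun z : ZMod p => ZMod.stdAddChar ((a : ZMod p) * z ^ d),
    sum_zmod_eq_add_sum_units]
  simp only [zero_pow hd0, mul_zero, AddChar.map_zero_eq_one]
  congr 1
  have := sum_units_pow hd (fun u : (ZMod p)ˣ => ZMod.stdAddChar ((a : ZMod p) * (u : ZMod p)))
  simp only [Units.val_pow_eq_pow_val] at this
  exact this

/-- The powers `g ^ (dx + y)`, `1 ≤ x ≤ t`, of a generator run over a coset of the subgroup of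
`d`-th powers, and every coset arises in this way. -/
lemma exists_sum_coset_eq (g : (ZMod p)ˣ) (hg : ∀ u : (ZMod p)ˣ, u ∈ Subgroup.zpowers g)
    {d t : ℕ} (hdt : d * t = p - 1) (hd0 : 0 < d)
    [Fintype (powMonoidHom d : (ZMod p)ˣ →* (ZMod p)ˣ).range]
    (hcard : Fintype.card (powMonoidHom d : (ZMod p)ˣ →* (ZMod p)ˣ).range = t)
    (u : (ZMod p)ˣ) :
    ∃ y ∈ Finset.Icc 1 d, ∀ F : (ZMod p)ˣ → ℝ, ∑ x ∈ Finset.Icc 1 t, F (g ^ (d * x + y)) =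
      ∑ h : (powMonoidHom d : (ZMod p)ˣ →* (ZMod p)ˣ).range, F (u * h) := by
  classical
  obtain ⟨i, hi : g ^ i = u⟩ := mem_powers_iff_mem_zpowers.2 (hg u)
  have hord : orderOf g = p - 1 := by
    rw [orderOf_eq_card_of_forall_mem_zpowers hg, Nat.card_eq_fintype_card, ZMod.card_units]
  -- The representative `y` must lie in `[1, d]` rather than `[0, d)`; adding `d` to `i` keeps `q`
  -- natural.
  obtain ⟨y, hy, q, hq⟩ : ∃ y ∈ Finset.Icc 1 d, ∃ q, i + d = d * q + y := by
    by_cases hm : i % d = 0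
    · refine ⟨d, Finset.mem_Icc.2 ⟨hd0, le_rfl⟩, i / d, ?_⟩
      have := Nat.div_add_mod i d
      omega
    · refine ⟨i % d, Finset.mem_Icc.2 ⟨by omega, (Nat.mod_lt _ hd0).le⟩, i / d + 1, ?_⟩
      have := Nat.div_add_mod i d
      rw [mul_add]
      omega
  refine ⟨y, hy, fun F => ?_⟩
  let f : ℕ → (powMonoidHom d : (ZMod p)ˣ →* (ZMod p)ˣ).range := fun x =>
    ⟨(g * g ^ x * (g ^ q)⁻¹) ^ d, _, rfl⟩
  have hf : ∀ x, u * (f x : (ZMod p)ˣ) = g ^ (d * x + y) := by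
    intro x
    have h1 : (f x : (ZMod p)ˣ) = g ^ d * g ^ (d * x) * (g ^ (d * q))⁻¹ := by
      simp only [f, mul_pow, inv_pow, ← pow_mul, mul_comm]
    rw [h1, ← hi, ← mul_assoc, mul_inv_eq_iff_eq_mul, ← pow_add, ← pow_add, ← pow_add]
    congr 1
    omega
  have hinj : Set.InjOn f (Finset.Icc 1 t : Finset ℕ) := by
    intro x hx x' hx' h
    have h1 : g ^ (d * x + y) = g ^ (d * x' + y) := by rw [← hf, ← hf, h]
    rw [pow_eq_pow_iff_modEq, hord, ← hdt] at h1
    have h2 : x ≡ x' [MOD t] :=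
      Nat.ModEq.mul_left_cancel' hd0.ne' (Nat.ModEq.add_right_cancel' y h1)
    simp only [Finset.coe_Icc, Set.mem_Icc] at hx hx'
    have h3 : x - 1 ≡ x' - 1 [MOD t] :=
      Nat.ModEq.add_right_cancel' 1 (by
        rwa [Nat.sub_add_cancel hx.1, Nat.sub_add_cancel hx'.1])
    have := Nat.ModEq.eq_of_lt_of_lt h3 (by omega) (by omega)
    omega
  have himg : (Finset.Icc 1 t).image f = Finset.univ := by
    apply Finset.eq_univ_of_card
    rw [Finset.card_image_of_injOn hinj, hcard, Nat.card_Icc]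
    omega
  rw [← himg, Finset.sum_image hinj]
  exact Finset.sum_congr rfl fun x _ => by rw [hf]

lemma re_gaussPeriod_le (H : Subgroup (ZMod p)ˣ) [Fintype H] (b : ZMod p) :
    (gaussPeriod H b).re ≤ Fintype.card H -
      8 / (p : ℝ) ^ 2 * ∑ h : H, ((b * ((h : (ZMod p)ˣ) : ZMod p)).valMinAbs : ℝ) ^ 2 := by
  rw [gaussPeriod, Complex.re_sum]
  refine (Finset.sum_le_sum fun h _ => ZMod.re_stdAddChar_le _).trans (le_of_eq ?_)
  rw [Finset.sum_sub_distrib, Finset.mul_sum]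
  simp only [Finset.sum_const, Finset.card_univ, nsmul_eq_mul, mul_one]
  congr 1
  exact Finset.sum_congr rfl fun h _ => by ring

end PowerSubgroup

/-! ### Numerical inequalities in `p` and `d` -/

section Estimates

lemma log_le_rpow_div_mul_exp_one {p ε : ℝ} (hp : 0 < p) (hε : 0 < ε) :
    Real.log p ≤ p ^ ε / (ε * Real.exp 1) := by
  have h := Real.add_one_le_exp (ε * Real.log p - 1)
  rw [Real.exp_sub, mul_comm ε, ← Real.rpow_def_of_pos hp] at h
  rw [← div_div, div_right_comm, le_div_iff₀ hε]
  linarith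

lemma mul_log_lt_mul_rpow {p ε c c' : ℝ} (hp : 0 < p) (hε : 0 < ε) (hc : 0 < c)
    (h : c ≤ c' * (ε * 2.7182818283)) (hc' : 0 < c') :
    c * Real.log p < c' * p ^ ε := by
  have h1 := log_le_rpow_div_mul_exp_one hp hε
  have h2 := Real.exp_one_gt_d9
  have hpe : 0 < p ^ ε := Real.rpow_pos_of_pos hp _
  calc c * Real.log p ≤ c * (p ^ ε / (ε * Real.exp 1)) := by gcongr
    _ = c / (ε * Real.exp 1) * p ^ ε := by ring
    _ < c' * p ^ ε := by
      gcongr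
      rw [div_lt_iff₀ (by positivity)]
      refine h.trans_lt ?_
      gcongr

lemma rpow_le_rpow_mul_sq {p d t α : ℝ} (hp : 375000 ≤ p) (hd : 0 < d) (hdt : d * t = p - 1)
    (h : p ^ α ≤ d) :
    0.999 * p ^ (49 / 25 * (1 + α)) ≤ p ^ (48 / 25 : ℝ) * t ^ (1 / 25 : ℝ) * d ^ 2 := by
  have hp0 : 0 < p := by linarith
  have ht : 0 < t := by
    by_contra! h'
    nlinarith
  have h1 : d ^ 2 = d ^ (1 / 25 : ℝ) * d ^ (49 / 25 : ℝ) := by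
    rw [← Real.rpow_add hd, ← Real.rpow_natCast]
    norm_num
  have h2 : (0.999 : ℝ) ≤ 0.999 ^ (1 / 25 : ℝ) := by
    conv_lhs => rw [← Real.rpow_one 0.999]
    exact Real.rpow_le_rpow_of_exponent_ge (by norm_num) (by norm_num) (by norm_num)
  have h3 : 0.999 * p ^ (1 / 25 : ℝ) ≤ (d * t) ^ (1 / 25 : ℝ) := by
    calc 0.999 * p ^ (1 / 25 : ℝ) ≤ 0.999 ^ (1 / 25 : ℝ) * p ^ (1 / 25 : ℝ) := by gcongr
      _ = (0.999 * p) ^ (1 / 25 : ℝ) := by rw [Real.mul_rpow (by norm_num) hp0.le]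
      _ ≤ _ := by
        rw [hdt]
        gcongr
        linarith
  rw [Real.mul_rpow hd.le ht.le] at h3
  have h4 : p ^ (α * (49 / 25)) ≤ d ^ (49 / 25 : ℝ) := by
    rw [Real.rpow_mul hp0.le]
    gcongr
  calc 0.999 * p ^ (49 / 25 * (1 + α))
      = p ^ (48 / 25 : ℝ) * (0.999 * p ^ (1 / 25 : ℝ)) * p ^ (α * (49 / 25)) := by
        rw [show (49 / 25 * (1 + α) : ℝ) = 48 / 25 + 1 / 25 + α * (49 / 25) by ring,
          Real.rpow_add hp0, Real.rpow_add hp0]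
        ring
    _ ≤ p ^ (48 / 25 : ℝ) * (d ^ (1 / 25 : ℝ) * t ^ (1 / 25 : ℝ)) * d ^ (49 / 25 : ℝ) := by
        gcongr
    _ = _ := by rw [h1]; ring

/-- If `d ≥ p^α`, the left side of `h` is at least `0.999 c p^(49(1+α)/25)`, whose exponent exceeds
3 exactly when `α > 26/49`; the surplus power beats `log p`. -/
lemma lt_rpow_of_mul_le_log {p d t α c : ℝ} (hp : 375000 ≤ p) (hd : 0 < d)
    (hdt : d * t = p - 1) (hα : 26 / 49 < α) (hc : 0 < c)
    (hcα : 1 ≤ 0.999 * c * ((49 / 25 * (1 + α) - 3) * 2.7182818283))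
    (h : c * (p ^ (48 / 25 : ℝ) * t ^ (1 / 25 : ℝ) * d ^ 2) ≤ p ^ 3 * Real.log p) :
    d < p ^ α := by
  by_contra! h'
  have hp0 : 0 < p := by linarith
  have h1 := rpow_le_rpow_mul_sq hp hd hdt h'
  have h2 := mul_log_lt_mul_rpow (p := p) (ε := 49 / 25 * (1 + α) - 3) (c := 1) (c' := 0.999 * c)
    hp0 (by linarith) one_pos hcα (by positivity)
  have h3 : p ^ (49 / 25 * (1 + α)) = p ^ 3 * p ^ (49 / 25 * (1 + α) - 3) := by
    rw [← Real.rpow_natCast p 3, ← Real.rpow_add hp0]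
    congr 1
    push_cast
    ring
  rw [h3] at h1
  have h4 : c * (0.999 * (p ^ 3 * p ^ (49 / 25 * (1 + α) - 3))) ≤ p ^ 3 * Real.log p :=
    (mul_le_mul_of_nonneg_left h1 hc.le).trans h
  have h5 := mul_lt_mul_of_pos_left h2 (show 0 < p ^ 3 by positivity)
  linarith

lemma quartic_lt_of_endpoints {A B κ a b x : ℝ} (hA : 0 ≤ A) (hκ : 0 ≤ κ) (ha : 0 ≤ a) (hax : a ≤ x)
    (hxb : x ≤ b) (h1 : A * a ^ 4 + B < κ * a) (h2 : A * b ^ 4 + B < κ * b) :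
    A * x ^ 4 + B < κ * x := by
  have hconv : ConvexOn ℝ (Set.Ici 0) fun y : ℝ => A * y ^ 4 + B - κ * y := by
    have h := ((convexOn_pow 4).smul hA).add_const B
    exact h.sub ((concaveOn_id (convex_Ici 0)).smul hκ)
  have h := hconv.le_max_of_mem_Icc (x := a) (y := b) (z := x) ha
    (ha.trans (hax.trans hxb)) ⟨hax, hxb⟩
  have : max (A * a ^ 4 + B - κ * a) (A * b ^ 4 + B - κ * b) < 0 := max_lt (by linarith)
    (by linarith)
  have h3 := h.trans_lt this
  linarith

lemma pow_le_pow_mul_of_le {c P : ℝ} (hc : 1 ≤ c) (hcP : c ≤ P) {m n : ℕ} (hmn : m ≤ n) :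
    P ^ m * c ^ (n - m) ≤ P ^ n := by
  have hP : 0 < P := by linarith
  calc P ^ m * c ^ (n - m) ≤ P ^ m * P ^ (n - m) := by gcongr
    _ = P ^ n := by rw [← pow_add, Nat.add_sub_cancel' hmn]

lemma rpow_natCast_div {p : ℝ} (hp : 0 < p) (n : ℕ) :
    p ^ ((n : ℝ) / 400) = (p ^ (1 / 400 : ℝ)) ^ n := by
  rw [← Real.rpow_natCast, ← Real.rpow_mul hp.le]
  congr 1
  ring

/-- All exponents in the numerical part are multiples of `1/400`, so this bound carries the size of
`p`. -/
lemma le_rpow_one_div {p : ℝ} (hp : 375000 ≤ p) : 1.0326 ≤ p ^ (1 / 400 : ℝ) := by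
  have hp0 : 0 < p := by linarith
  by_contra! h
  have h1 : (p ^ (1 / 400 : ℝ)) ^ 200 ≤ 1.0326 ^ 200 := by gcongr
  rw [← rpow_natCast_div hp0] at h1
  have h2 : (1.0326 : ℝ) ^ 200 < 612 := by norm_num
  have h3 : (p ^ (((200 : ℕ) : ℝ) / 400)) ^ 2 = p := by
    rw [← Real.rpow_natCast, ← Real.rpow_mul hp0.le]
    norm_num
  have h4 : 0 ≤ p ^ (((200 : ℕ) : ℝ) / 400) := by positivity
  nlinarith

/-- In terms of `x = √d` the left side is at most a convex quartic and the right side is at least a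
linear function, so the endpoints `x = p^(98/400)` and `x = b` suffice. -/
lemma lt_sqrt_of_mem_range {p d t α β b : ℝ} (hp : 375000 ≤ p) (hdt : d * t = p - 1)
    (hα : 0 ≤ α) (hd1 : p ^ (49 / 100 : ℝ) ≤ d) (hd2 : d ≤ p ^ (58 / 100 : ℝ))
    (hb0 : 0 ≤ b) (hb : d ≤ b ^ 2)
    (hleft : α * 1.005 + β < 0.4515 * (p ^ (1 / 400 : ℝ)) ^ 83)
    (hright : α * 1.005 / p * b ^ 4 + β < 0.4515 * b / (p ^ (1 / 400 : ℝ)) ^ 15) :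
    α * (d / (t - 1)) + β < √(t / (p * Real.log p / d ^ 2)) := by
  have hp0 : 0 < p := by linarith
  have hPr := rpow_natCast_div hp0
  have hP := le_rpow_one_div hp
  set P := p ^ (1 / 400 : ℝ) with hPdef
  have hP400 : p = P ^ 400 := by
    have := hPr 400
    norm_num at this
    exact this
  have hP0 : 0 < P := by linarith
  have hP1 : 1 ≤ P := by linarith
  have hd1' : P ^ 196 ≤ d := by
    rw [← hPr]; convert hd1 using 2; norm_num
  have hd2' : d ≤ P ^ 232 := by
    rw [← hPr]; convert hd2 using 2; norm_num
  have hd0 : 0 < d := lt_of_lt_of_le (by positivity) hd1'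
  have ht0 : 0 < t := by
    by_contra! h'
    nlinarith
  -- This makes `p - 1 - d = d(t - 1)` comparable to `p` up to the factor `1.005`.
  have hdp : 219 * d ≤ p := by
    have h1 := pow_le_pow_mul_of_le (by norm_num) hP (show 232 ≤ 400 by norm_num)
    have h2 : (219 : ℝ) ≤ 1.0326 ^ 168 := by norm_num
    rw [← hP400] at h1
    calc 219 * d ≤ 1.0326 ^ 168 * P ^ 232 := by gcongr
      _ ≤ p := by rw [mul_comm]; exact h1
  have hden : p ≤ 1.005 * (p - 1 - d) := by linarith
  have hquot : d / (t - 1) ≤ 1.005 * d ^ 2 / p := by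
    have h1 : d / (t - 1) = d ^ 2 / (p - 1 - d) := by
      rw [← hdt, sq, show d * t - d = d * (t - 1) by ring, mul_div_mul_left _ _ hd0.ne']
    rw [h1, div_le_div_iff₀ (by linarith) hp0]
    nlinarith [sq_nonneg d]
  have hx0 : 0 ≤ √d := Real.sqrt_nonneg d
  have hx2 : √d ^ 2 = d := Real.sq_sqrt hd0.le
  have key := quartic_lt_of_endpoints (A := α * 1.005 / p) (B := β) (κ := 0.4515 / P ^ 15)
    (a := P ^ 98) (b := b) (x := √d) (by positivity) (by positivity) (by positivity)
    (Real.le_sqrt_of_sq_le (by rw [← pow_mul]; exact hd1'))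
    ((Real.sqrt_le_left hb0).2 hb) (by
      have h1 : 0.4515 / P ^ 15 * P ^ 98 = 0.4515 * P ^ 83 := by
        rw [show 98 = 83 + 15 by norm_num, pow_add]
        field_simp
      rw [h1]
      refine lt_of_le_of_lt ?_ hleft
      have h2 : P ^ (98 * 4) ≤ p := by
        conv_rhs => rw [hP400]
        exact pow_le_pow_right₀ hP1 (by norm_num)
      have h3 : α * 1.005 / p * (P ^ 98) ^ 4 ≤ α * 1.005 := by
        rw [div_mul_eq_mul_div, div_le_iff₀ hp0, ← pow_mul]
        gcongr
      linarith) (by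
      rw [div_mul_eq_mul_div (0.4515 : ℝ)]; exact hright)
  -- Here `0.203871` is just below `0.075 e`, with `0.075 = 30/400`; `0.4515` is just below its
  -- square root, leaving room to replace `p` by `p - 1`.
  have hL : Real.log p ≤ P ^ 30 / 0.203871 := by
    have h := mul_log_lt_mul_rpow (p := p) (ε := (30 : ℕ) / 400) (c := 0.203871) (c' := 1) hp0
      (by norm_num) (by norm_num) (by norm_num) (by norm_num)
    rw [hPr] at h
    rw [le_div_iff₀ (by norm_num)]
    linarith
  have hLpos : 0 < Real.log p := Real.log_pos (by linarith)
  have hsqrt : 0.4515 / P ^ 15 * √d ≤ √(t / (p * Real.log p / d ^ 2)) := by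
    apply Real.le_sqrt_of_sq_le
    have h1 : t / (p * Real.log p / d ^ 2) = d * (p - 1) / (p * Real.log p) := by
      rw [← hdt]
      field_simp
    rw [h1, mul_pow, hx2, div_pow, ← pow_mul, le_div_iff₀ (by positivity)]
    calc 0.4515 ^ 2 / P ^ (15 * 2) * d * (p * Real.log p)
        ≤ 0.4515 ^ 2 / P ^ (15 * 2) * d * (p * (P ^ 30 / 0.203871)) := by gcongr
      _ = d * (0.4515 ^ 2 / 0.203871 * p) := by field_simp
      _ ≤ d * (p - 1) := by
        gcongr
        norm_num
        linarith
  have hx4 : √d ^ 4 = d ^ 2 := by rw [← hx2, ← pow_mul, hx2]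
  rw [hx4] at key
  have h2 := mul_le_mul_of_nonneg_left hquot hα
  calc α * (d / (t - 1)) + β ≤ α * (1.005 * d ^ 2 / p) + β := by linarith
    _ = α * 1.005 / p * d ^ 2 + β := by ring
    _ < _ := key
    _ ≤ _ := hsqrt

end Estimates

/-! ### The key bound and the final comparison -/

section Main

lemma linear_lt_sqrt {p d t α β : ℝ} {e : ℕ} (hp : 375000 ≤ p) (hdt : d * t = p - 1)
    (hα : 0 ≤ α) (hβ : 0 ≤ β) (he : 100 ≤ e) (he' : e ≤ 116)
    (hd1 : p ^ (49 / 100 : ℝ) ≤ d) (hd2 : d ≤ p ^ (((2 * e : ℕ) : ℝ) / 400))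
    (hleft : α * 1.005 + β < 0.4515 * 1.0326 ^ 83)
    (hright : α * 1.005 * 1.0326 ^ (4 * e - 400) + β < 0.4515 * 1.0326 ^ (e - 15)) :
    α * (d / (t - 1)) + β < √(t / (p * Real.log p / d ^ 2)) := by
  have hp0 : 0 < p := by linarith
  have hPr := rpow_natCast_div hp0
  have hP := le_rpow_one_div hp
  refine lt_sqrt_of_mem_range (b := (p ^ (1 / 400 : ℝ)) ^ e) hp hdt hα hd1 (hd2.trans ?_)
    (by positivity) (by rwa [← pow_mul, mul_comm e, ← hPr]) (hleft.trans_le (by gcongr)) ?_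
  · refine Real.rpow_le_rpow_of_exponent_le (by linarith) ?_
    have : (e : ℝ) ≤ 116 := by exact_mod_cast he'
    push_cast
    linarith
  have hP400 := hPr 400
  set P := p ^ (1 / 400 : ℝ)
  norm_num at hP400
  have hP0 : 0 < P := by linarith
  have h1 : α * 1.005 / p * (P ^ e) ^ 4 = α * 1.005 * P ^ (4 * e - 400) := by
    rw [← pow_mul, mul_comm e 4]
    conv_lhs => rw [hP400, ← Nat.sub_add_cancel (show 400 ≤ 4 * e by omega), pow_add]
    field_simp
  have h2 : 0.4515 * P ^ e / P ^ 15 = 0.4515 * P ^ (e - 15) := by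
    conv_lhs => rw [← Nat.sub_add_cancel (show 15 ≤ e by omega), pow_add]
    field_simp
  rw [h1, h2]
  obtain ⟨s, hs1, hs⟩ : ∃ s : ℝ, 1 ≤ s ∧ P = 1.0326 * s :=
    ⟨P / 1.0326, by rw [le_div_iff₀ (by norm_num)]; linarith, by field_simp⟩
  rw [hs, mul_pow, mul_pow]
  -- The right side grows faster in `s`, so the check at `P = 1.0326` is decisive.
  have h3 : s ^ (4 * e - 400) ≤ s ^ (e - 15) := pow_le_pow_right₀ hs1 (by omega)
  have h4 : 1 ≤ s ^ (e - 15) := one_le_pow₀ hs1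
  calc α * 1.005 * (1.0326 ^ (4 * e - 400) * s ^ (4 * e - 400)) + β
      ≤ α * 1.005 * (1.0326 ^ (4 * e - 400) * s ^ (e - 15)) + β * s ^ (e - 15) := by
        gcongr
        exact le_mul_of_one_le_right hβ h4
    _ = (α * 1.005 * 1.0326 ^ (4 * e - 400) + β) * s ^ (e - 15) := by ring
    _ < 0.4515 * 1.0326 ^ (e - 15) * s ^ (e - 15) := by gcongr
    _ = _ := by ring

lemma linear_lt_sqrt_of_lt_rpow_111 {p d t : ℝ} (hp : 375000 ≤ p) (hdt : d * t = p - 1)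
    (hd1 : p ^ (49 / 100 : ℝ) ≤ d) (hd2 : d < p ^ (111 / 200 : ℝ)) :
    1.875 * (d / (t - 1)) + 2 < √(t / (p * Real.log p / d ^ 2)) := by
  refine linear_lt_sqrt (e := 111) hp hdt (by norm_num) (by norm_num) (by norm_num)
    (by norm_num) hd1 (hd2.le.trans (le_of_eq ?_)) (by norm_num) (by norm_num)
  norm_num

lemma linear_lt_sqrt_of_lt_rpow_116 {p d t : ℝ} (hp : 375000 ≤ p) (hdt : d * t = p - 1)
    (hd1 : p ^ (49 / 100 : ℝ) ≤ d) (hd2 : d < p ^ (116 / 200 : ℝ)) :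
    0.9375 * (d / (t - 1)) + 3.875 < √(t / (p * Real.log p / d ^ 2)) := by
  refine linear_lt_sqrt (e := 116) hp hdt (by norm_num) (by norm_num) (by norm_num)
    (by norm_num) hd1 (hd2.le.trans (le_of_eq ?_)) (by norm_num) (by norm_num)
  norm_num

lemma three_le_log {p : ℝ} (hp : 375000 ≤ p) : 3 ≤ Real.log p := by
  rw [Real.le_log_iff_exp_le (by linarith)]
  have h1 : Real.exp 3 = Real.exp 1 ^ 3 := by rw [← Real.exp_nat_mul]; norm_num
  have h2 : Real.exp 1 ^ 3 ≤ 2.72 ^ 3 := by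
    gcongr
    linarith [Real.exp_one_lt_d9]
  rw [h1]
  refine h2.trans (le_trans (by norm_num) hp)

lemma one_add_mul_sqrt_le {p d n : ℝ} (hp : 375000 ≤ p) (hn : 2000 ≤ n)
    (hd : d ≤ p ^ (49 / 100 : ℝ)) : 1 + d * √p ≤ p ^ (1 - 1 / n) := by
  have hp0 : 0 < p := by linarith
  have hp1 : 1 ≤ p := by linarith
  have h1 : d * √p ≤ p ^ (99 / 100 : ℝ) := by
    calc d * √p ≤ p ^ (49 / 100 : ℝ) * √p := by gcongr
      _ = p ^ (99 / 100 : ℝ) := by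
        rw [Real.sqrt_eq_rpow, ← Real.rpow_add hp0]
        norm_num
  -- `19/2000` is the gap between `99/100` and `1 - 1/2000`, and `1.0285 = 1 + 3 · 19/2000`.
  have h2 : 1.0285 ≤ p ^ (19 / 2000 : ℝ) := by
    rw [Real.rpow_def_of_pos hp0]
    have := Real.add_one_le_exp (Real.log p * (19 / 2000))
    have := three_le_log hp
    linarith
  have h3 : 100 ≤ p ^ (99 / 100 : ℝ) := by
    have h : (10000 : ℝ) ^ (1 / 2 : ℝ) = 100 := by
      rw [← Real.sqrt_eq_rpow, show (10000 : ℝ) = 100 ^ 2 by norm_num]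
      exact Real.sqrt_sq (by norm_num)
    rw [← h]
    calc (10000 : ℝ) ^ (1 / 2 : ℝ) ≤ p ^ (1 / 2 : ℝ) := by gcongr; linarith
      _ ≤ _ := Real.rpow_le_rpow_of_exponent_le hp1 (by norm_num)
  calc 1 + d * √p ≤ 1 + p ^ (99 / 100 : ℝ) := by linarith
    _ ≤ p ^ (99 / 100 : ℝ) * p ^ (19 / 2000 : ℝ) := by nlinarith
    _ = p ^ (1999 / 2000 : ℝ) := by rw [← Real.rpow_add hp0]; norm_num
    _ ≤ _ := by
      refine Real.rpow_le_rpow_of_exponent_le hp1 ?_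
      have : 1 / n ≤ 1 / 2000 := by gcongr
      linarith

lemma mul_one_sub_log_div_le_rpow {p d n : ℝ} (hp : 1 ≤ p) (hd : 0 < d) (hdn : d ≤ n) :
    p - p * Real.log p / d ≤ p ^ (1 - 1 / n) := by
  have hp0 : 0 < p := by linarith
  have hL : 0 ≤ Real.log p := Real.log_nonneg hp
  have h := Real.add_one_le_exp (-(Real.log p / n))
  rw [Real.rpow_sub hp0, Real.rpow_one, Real.rpow_def_of_pos hp0, div_eq_mul_inv p, ← Real.exp_neg]
  have h2 : Real.log p / n ≤ Real.log p / d := by gcongr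
  rw [mul_one_div]
  have h3 := mul_le_mul_of_nonneg_left h hp0.le
  have h4 := mul_le_mul_of_nonneg_left h2 hp0.le
  have h5 : p * Real.log p / d = p * (Real.log p / d) := by ring
  linarith

lemma le_two_mul_of_sq_le {T X N m : ℝ} (hT : 0 ≤ T) (h : T - X ≤ N)
    (hm : N ^ 2 ≤ T ^ 2 - m) : m ≤ 2 * T * X := by
  rcases le_total X T with hXT | hXT
  · have := pow_le_pow_left₀ (sub_nonneg.2 hXT) h 2
    nlinarith [sq_nonneg X]
  · have := mul_le_mul_of_nonneg_left hXT hT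
    nlinarith [sq_nonneg N]

lemma mul_sq_le_of_div_sq_le {c p d V L : ℝ} (hp : 0 < p) (hd : 0 < d)
    (h : c / p ^ 2 * V ≤ p * L / d ^ 2) : c * (V * d ^ 2) ≤ p ^ 3 * L := by
  rw [div_mul_eq_mul_div, div_le_div_iff₀ (by positivity) (by positivity)] at h
  linarith

/-- The key bound: if all nonzero Gaussian periods have real part well below `t`, then they are
all small enough in absolute value. -/
lemma norm_gaussPeriod_le_sub {p : ℕ} [Fact p.Prime] (H : Subgroup (ZMod p)ˣ) [Fintype H]
    {d : ℕ} (hp : 375000 ≤ p) (hdt : d * Fintype.card H = p - 1) (ht : 26 ≤ Fintype.card H)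
    (hd : (p : ℝ) ^ (49 / 100 : ℝ) ≤ d)
    (hre : ∀ b : ZMod p, b ≠ 0 → (gaussPeriod H b).re ≤ Fintype.card H -
      8 / (p : ℝ) ^ 2 * ((p : ℝ) ^ (48 / 25 : ℝ) * (Fintype.card H : ℝ) ^ (1 / 25 : ℝ)))
    {a : ZMod p} (ha : a ≠ 0) :
    ‖gaussPeriod H a‖ ≤ Fintype.card H - p * Real.log p / (d : ℝ) ^ 2 := by
  by_contra! hlarge
  have hp' : (375000 : ℝ) ≤ p := by exact_mod_cast hp
  have hp0 : (0 : ℝ) < p := by linarith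
  have hdt' : (d : ℝ) * (Fintype.card H : ℝ) = p - 1 := by
    rw [← Nat.cast_mul, hdt, Nat.cast_sub (by omega), Nat.cast_one]
  have ht' : (26 : ℝ) ≤ Fintype.card H := by exact_mod_cast ht
  have hsq := norm_gaussPeriod_sq_le H hre ha
  have hd0 : (0 : ℝ) < d := lt_of_lt_of_le (Real.rpow_pos_of_pos hp0 _) hd
  have hLog := three_le_log hp'
  set V := (p : ℝ) ^ (48 / 25 : ℝ) * (Fintype.card H : ℝ) ^ (1 / 25 : ℝ) with hV
  have hV0 : 0 ≤ V := by positivity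
  obtain ⟨X, hX⟩ : ∃ X, X = p * Real.log p / (d : ℝ) ^ 2 := ⟨_, rfl⟩
  have hX0 : 0 < X := by rw [hX]; positivity
  have hXd : X * (d : ℝ) ^ 2 = p * Real.log p := by rw [hX]; field_simp
  rw [← hX] at hlarge
  set T : ℝ := (Fintype.card H : ℝ) with hT
  -- The bound `T - k²X` vanishes at `k = y`, so `K = ⌊y⌋` is the last useful layer.
  set y := √(T / X) with hy
  have hy0 : 0 ≤ y := Real.sqrt_nonneg _
  have hy2 : y ^ 2 * X = T := by
    rw [hy, Real.sq_sqrt (by positivity)]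
    field_simp
  set K := ⌊y⌋₊ with hK
  have hKy : (K : ℝ) ≤ y := Nat.floor_le hy0
  have hyK : y < K + 1 := Nat.lt_floor_add_one y
  have hKX : (K : ℝ) ^ 2 * X ≤ T := by rw [← hy2]; gcongr
  -- Cauchy–Davenport must not saturate at `p`: `2K + 1 ≤ 3K² ≤ K² log p ≤ d`.
  have hKd : 1 ≤ K → (2 * K + 1) * Fintype.card H + 1 ≤ p := by
    intro hK1
    have h1 : (1 : ℝ) ≤ K := by exact_mod_cast hK1
    have h2 : (K : ℝ) ^ 2 * (p * Real.log p) ≤ p * d := by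
      calc (K : ℝ) ^ 2 * (p * Real.log p) = (K : ℝ) ^ 2 * X * (d : ℝ) ^ 2 := by rw [← hXd]; ring
        _ ≤ T * (d : ℝ) ^ 2 := by gcongr
        _ = (d * T) * d := by ring
        _ ≤ p * d := by rw [hdt']; gcongr; linarith
    have h3 : (K : ℝ) ^ 2 * Real.log p ≤ d := by
      have : p * ((K : ℝ) ^ 2 * Real.log p) ≤ p * d := by linarith
      exact le_of_mul_le_mul_left this hp0
    have h4 : ((2 * K + 1 : ℕ) : ℝ) ≤ d := by
      push_cast
      nlinarith
    have h5 : 2 * K + 1 ≤ d := by exact_mod_cast h4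
    have h6 := Nat.mul_le_mul_right (Fintype.card H) h5
    omega
  have hTpos : 0 < T := by linarith
  have hT1 : 0 < T - 1 := by linarith
  by_cases hcase : (gaussPeriod H a).re = ‖gaussPeriod H a‖
  · have h1 := hre a ha
    rw [hcase] at h1
    have h2 : 8 * (V * (d : ℝ) ^ 2) ≤ (p : ℝ) ^ 3 * Real.log p :=
      mul_sq_le_of_div_sq_le hp0 hd0 (by rw [← hX]; linarith)
    have hdlt := lt_rpow_of_mul_le_log (α := 111 / 200) hp' hd0 hdt' (by norm_num) (by norm_num)
      (by norm_num) h2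
    have hnum := linear_lt_sqrt_of_lt_rpow_111 hp' hdt' hd hdlt
    rw [← hX, ← hy] at hnum
    have hq : 0 < d / (T - 1) := by positivity
    have hK1 : 1 ≤ K := by
      have : (1 : ℝ) < K := by linarith
      exact_mod_cast this.le
    have hS := le_sum_max_sq hX0.le hK1 hKX
    have hC := sum_le_of_norm_gaussPeriod_ge H ha hX0.le hlarge.le (K := K)
      (le_trans (by gcongr; omega) (hKd hK1))
    have h5 : (T - 1) * (8 / 15 * ((K : ℝ) - 1) * T ^ 2) ≤ p * T - T ^ 2 :=
      (mul_le_mul_of_nonneg_left hS hT1.le).trans hC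
    -- `1.875 = 15/8`; the constant 2 in `hnum` covers the floor and the `- 1`.
    have h6 : d / (T - 1) < 8 / 15 * ((K : ℝ) - 1) := by linarith
    rw [div_lt_iff₀ hT1] at h6
    have h7 := mul_lt_mul_of_pos_right h6 (show 0 < T ^ 2 by positivity)
    have h8 : (p - 1) * T < p * T - T ^ 2 := by rw [← hdt']; linarith
    have h9 := mul_pos hTpos hT1
    linarith
  -- `50/13 = (8/2)(25/26)`: half is lost in passing from `|η|²` to `|η|`, and `T - 1 ≥ (25/26) T`
  -- since `T ≥ 26`.
  · have h2 : (50 / 13 : ℝ) * (V * (d : ℝ) ^ 2) ≤ (p : ℝ) ^ 3 * Real.log p := by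
      have h1 : (T - 1) * (8 / (p : ℝ) ^ 2 * V) ≤ 2 * T * X :=
        le_two_mul_of_sq_le hTpos.le hlarge.le hsq
      have h3 : 25 / 26 * T * (8 / (p : ℝ) ^ 2 * V) ≤ 2 * T * X := by
        refine le_trans ?_ h1
        gcongr
        linarith
      have h4 : (50 / 13 : ℝ) / (p : ℝ) ^ 2 * V ≤ X := by
        have : (2 * T) * ((50 / 13 : ℝ) / (p : ℝ) ^ 2 * V) ≤ (2 * T) * X := by
          refine le_trans (le_of_eq ?_) h3
          ring
        exact le_of_mul_le_mul_left this (by positivity)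
      exact mul_sq_le_of_div_sq_le hp0 hd0 (by rw [← hX]; exact h4)
    have hdlt := lt_rpow_of_mul_le_log (α := 116 / 200) hp' hd0 hdt' (by norm_num) (by norm_num)
      (by norm_num) h2
    have hnum := linear_lt_sqrt_of_lt_rpow_116 hp' hdt' hd hdlt
    rw [← hX, ← hy] at hnum
    have hq : 0 < d / (T - 1) := by positivity
    have hK1 : 1 ≤ K := by
      have : (1 : ℝ) < K := by linarith
      exact_mod_cast this.le
    have hS := le_sum_max_sq hX0.le hK1 hKX
    have hC := two_mul_sum_le H ha hX0.le hlarge.le hcase hK1 (hKd hK1)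
    have h5 : 2 * (T - 1) * (8 / 15 * ((K : ℝ) - 1) * T ^ 2 - T ^ 2) ≤ p * T - T ^ 2 := by
      refine le_trans ?_ hC
      gcongr
    -- Doubling halves the slope to `15/16`; the lost `T²` raises the constant from 2 to `2 + 15/8`.
    have h6 : d / (T - 1) < 2 * (8 / 15 * ((K : ℝ) - 1) - 1) := by linarith
    rw [div_lt_iff₀ hT1] at h6
    have h7 := mul_lt_mul_of_pos_right h6 (show 0 < T ^ 2 by positivity)
    have h8 : (p - 1) * T < p * T - T ^ 2 := by rw [← hdt']; linarith
    have h9 := mul_pos hTpos hT1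
    linarith

end Main

theorem corollary1 (n p d t : ℕ) (hp : p.Prime)
    (hd : d = Nat.gcd n (p - 1)) (ht : t = (p - 1) / d)
    (g : (ZMod p)ˣ) (hg : ∀ u : (ZMod p)ˣ, u ∈ Subgroup.zpowers g)
    (hn : 2000 ≤ n) (hφ : 25 ≤ Nat.totient t) (hp_large : 375000 ≤ p)
    (hsum : ∀ y ∈ Finset.Icc 1 d,
      (p : ℝ) ^ (48 / 25 : ℝ) * (t : ℝ) ^ (1 / 25 : ℝ) ≤
        ∑ x ∈ Finset.Icc 1 t, (bracket p ((g ^ (d * x + y) : (ZMod p)ˣ) : ZMod p) : ℝ) ^ 2) :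
    gaussG d p ≤ (p : ℝ) ^ (1 - 1 / (n : ℝ)) := by
  classical
  have : Fact p.Prime := ⟨hp⟩
  have : IsCyclic (ZMod p)ˣ := ⟨g, hg⟩
  have hdp : d ∣ p - 1 := hd ▸ Nat.gcd_dvd_right _ _
  have hd0 : 0 < d := hd ▸ Nat.gcd_pos_of_pos_left _ (by omega)
  have hdn : d ≤ n := hd ▸ Nat.gcd_le_left _ (by omega)
  have hdt : d * t = p - 1 := by rw [ht, Nat.mul_div_cancel' hdp]
  have ht26 : 26 ≤ t := by
    by_contra! h
    rcases Nat.lt_or_ge 1 t with h1 | h1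
    · have := Nat.totient_lt t h1
      omega
    · have := Nat.totient_le t
      omega
  have hcard : Fintype.card (powMonoidHom d : (ZMod p)ˣ →* (ZMod p)ˣ).range = t := by
    rw [card_powMonoidHom_range hdp, ht]
  have hp' : (375000 : ℝ) ≤ p := by exact_mod_cast hp_large
  have hn' : (2000 : ℝ) ≤ n := by exact_mod_cast hn
  have hd0' : (0 : ℝ) < d := by exact_mod_cast hd0
  have hdt' : (d : ℝ) * t = p - 1 := by
    rw [← Nat.cast_mul, hdt, Nat.cast_sub (by omega), Nat.cast_one]
  refine csSup_le ⟨_, 1, isCoprime_one_left, rfl⟩ ?_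
  rintro _ ⟨a, ha, rfl⟩
  have ha0 : (a : ZMod p) ≠ 0 := by
    intro h
    rw [ZMod.intCast_zmod_eq_zero_iff_dvd] at h
    have hu := ha.isUnit_of_dvd' h dvd_rfl
    have := Nat.isUnit_iff.1 (Int.ofNat_isUnit.1 hu)
    omega
  rw [gaussS_eq_gaussPeriod hdp hd0.ne']
  set H := (powMonoidHom d : (ZMod p)ˣ →* (ZMod p)ˣ).range
  have hnorm : ‖1 + (d : ℂ) * gaussPeriod H a‖ ≤ 1 + d * ‖gaussPeriod H a‖ := by
    refine (norm_add_le _ _).trans ?_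
    simp
  refine hnorm.trans ?_
  rcases le_total (d : ℝ) ((p : ℝ) ^ (49 / 100 : ℝ)) with hsmall | hlarge
  · refine le_trans ?_ (one_add_mul_sqrt_le hp' hn' hsmall)
    gcongr
    exact norm_gaussPeriod_le_sqrt H ha0
  have hre : ∀ b : ZMod p, b ≠ 0 → (gaussPeriod H b).re ≤ Fintype.card H -
      8 / (p : ℝ) ^ 2 * ((p : ℝ) ^ (48 / 25 : ℝ) * (Fintype.card H : ℝ) ^ (1 / 25 : ℝ)) := by
    intro b hb
    refine (re_gaussPeriod_le H b).trans ?_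
    gcongr
    -- The hypothesis ranges over all `y`, hence over all cosets `bH`.
    obtain ⟨y, hy, hyF⟩ := exists_sum_coset_eq g hg hdt hd0 hcard (Units.mk0 b hb)
    have h1 := hsum y hy
    rw [hyF fun u : (ZMod p)ˣ => (bracket p (u : ZMod p) : ℝ) ^ 2] at h1
    rw [hcard]
    exact h1
  have key := norm_gaussPeriod_le_sub H hp_large (by rw [hcard, hdt]) (by rw [hcard]; exact ht26) hlarge hre ha0
  rw [hcard] at key
  refine le_trans ?_ (mul_one_sub_log_div_le_rpow (by linarith) hd0'
    (show (d : ℝ) ≤ n by exact_mod_cast hdn))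
  have h1 := mul_le_mul_of_nonneg_left key hd0'.le
  have h2 : (d : ℝ) * (t - p * Real.log p / (d : ℝ) ^ 2) = p - 1 - p * Real.log p / d := by
    rw [mul_sub, hdt']
    field_simp
  linarith
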